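/- Let $D$ be a finite directed graph. A knot of $D$ is a strongly connected component with at least two vertices such that no arc of $D$ leads from a vertex of the component to a vertex outside it; $D$ is knot-free if it has no knot. A knot-free vertex deletion set of $D$ is a set $S\subseteq V(D)$ such that $D-S$ (the subgraph induced on $V(D)\setminus S$) is knot-free. Theorem. The number of inclusion-wise minimal knot-free vertex deletion sets of an $n$-vertex digraph is $\mathcal{O}^*(1.4549^n)$. That is, there is a polynomial $p$ such that, for every $n\ge 0$, every digraph on $n$ vertices has at most $p(n)\cdot 1.4549^n$ inclusion-wise minimal knot-free vertex deletion sets. -/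

import Mathlib

namespace KnotFree

variable {V : Type*}

/-- `K` is (the vertex set of) a strongly connected component of `D`: a class of the relation
"there are directed paths from `u` to `v` and from `v` to `u`". -/
def IsStronglyConnectedComponent (D : Digraph V) (K : Set V) : Prop :=
  K.Nonempty ∧ ∀ u ∈ K, ∀ v, v ∈ K ↔
    (Relation.ReflTransGen D.Adj u v ∧ Relation.ReflTransGen D.Adj v u)

/-- A knot: a strongly connected component with at least two vertices and no arc leaving it. -/
def IsKnot (D : Digraph V) (K : Set V) : Prop :=
  IsStronglyConnectedComponent D K ∧ K.Nontrivial ∧ ∀ u ∈ K, ∀ v, v ∉ K → ¬ D.Adj u v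

/-- A digraph is knot-free if it contains no knot. -/
def IsKnotFree (D : Digraph V) : Prop :=
  ∀ K : Set V, ¬ IsKnot D K

/-- The digraph `D - S`, that is, the subgraph of `D` induced on the vertices outside `S`. -/
def deleteVerts (D : Digraph V) (S : Set V) : Digraph {v : V // v ∉ S} where
  Adj u v := D.Adj u.1 v.1

/-- `S` is a knot-free vertex deletion set of `D` if `D - S` is knot-free. -/
def IsDeletionSet (D : Digraph V) (S : Set V) : Prop :=
  IsKnotFree (deleteVerts D S)

/-- The family of inclusion-wise minimal knot-free vertex deletion sets of `D`. -/
def minimalDeletionSets (D : Digraph V) : Set (Set V) :=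
  {S | Minimal (IsDeletionSet D) S}

end KnotFree

/-! A minimal deletion set `S` is determined by the sinks of `D - S`: it is the union of their
out-neighbourhoods (`exists_sink_of_mem`). No sink lies in the out-neighbourhood or the basin of
another (`disjoint_basin`), while a non-sink lies in some sink's out-neighbourhood if deleted and in
some sink's basin otherwise. So `sinks` injects the minimal deletion sets into the maximal
independent sets of `conflictGraph D`, and a Moon–Moser count bounds these by `1.4549 ^ n`, with `p
= 1`. -/

namespace KnotFree

open Relation

/-! ### Counting maximal independent sets. -/

section MaximalIndependentSets

variable {V : Type*} [DecidableEq V]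

open Classical in
/-- The maximal independent sets of the subgraph of `G` induced on `W`. -/
noncomputable def maxIndepSets (G : SimpleGraph V) (W : Finset V) : Finset (Finset V) :=
  {I ∈ W.powerset | (∀ u ∈ I, ∀ v ∈ I, ¬ G.Adj u v) ∧ ∀ v ∈ W, v ∉ I → ∃ u ∈ I, G.Adj v u}

open Classical in
/-- The closed neighbourhood of `u` within `W`. -/
noncomputable def closedNbhd (G : SimpleGraph V) (W : Finset V) (u : V) : Finset V :=
  {w ∈ W | w = u ∨ G.Adj u w}

lemma mem_maxIndepSets {G : SimpleGraph V} {W I : Finset V} :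
    I ∈ maxIndepSets G W ↔ I ⊆ W ∧ (∀ u ∈ I, ∀ v ∈ I, ¬ G.Adj u v) ∧
      ∀ v ∈ W, v ∉ I → ∃ u ∈ I, G.Adj v u := by
  simp [maxIndepSets]

lemma mem_closedNbhd {G : SimpleGraph V} {W : Finset V} {u w : V} :
    w ∈ closedNbhd G W u ↔ w ∈ W ∧ (w = u ∨ G.Adj u w) := by
  simp [closedNbhd]

lemma erase_mem_maxIndepSets {G : SimpleGraph V} {W I : Finset V} {u : V}
    (hI : I ∈ maxIndepSets G W) (hu : u ∈ I) :
    I.erase u ∈ maxIndepSets G (W \ closedNbhd G W u) := by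
  rw [mem_maxIndepSets] at hI ⊢
  obtain ⟨hIW, hind, hmax⟩ := hI
  refine ⟨fun w hw => ?_, fun a ha b hb =>
    hind a (Finset.mem_of_mem_erase ha) b (Finset.mem_of_mem_erase hb), fun w hw hwI => ?_⟩
  · rw [Finset.mem_erase] at hw
    rw [Finset.mem_sdiff, mem_closedNbhd]
    refine ⟨hIW hw.2, ?_⟩
    rintro ⟨-, h | h⟩
    · exact hw.1 h
    · exact hind u hu w hw.2 h
  · rw [Finset.mem_sdiff, mem_closedNbhd] at hw
    have hwu : w ≠ u := fun h => hw.2 ⟨hw.1, Or.inl h⟩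
    obtain ⟨a, ha, hwa⟩ := hmax w hw.1 fun h => hwI (Finset.mem_erase.2 ⟨hwu, h⟩)
    refine ⟨a, Finset.mem_erase.2 ⟨?_, ha⟩, hwa⟩
    rintro rfl
    exact hw.2 ⟨hw.1, Or.inr hwa.symm⟩

/-- If `k ≤ c ^ k` for all `k`, a graph on `n` vertices has at most `c ^ n` maximal independent
sets. The optimal choice is `c = 3 ^ (1 / 3)`. -/
theorem card_maxIndepSets_le (G : SimpleGraph V) {c : ℝ} (hc : 1 ≤ c)
    (hck : ∀ k : ℕ, (k : ℝ) ≤ c ^ k) (W : Finset V) :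
    ((maxIndepSets G W).card : ℝ) ≤ c ^ W.card := by
  induction W using Finset.strongInduction with
  | H W ih =>
  rcases W.eq_empty_or_nonempty with rfl | hW
  · have : maxIndepSets G ∅ ⊆ {∅} := fun I hI => by
      simpa using (mem_maxIndepSets.1 hI).1
    simpa using Finset.card_le_card this
  -- Every maximal independent set meets the closed neighbourhood of `v`. As this one is smallest,
  -- branching on any of its members removes at least `N.card` vertices.
  obtain ⟨v, hv, hmin⟩ := W.exists_min_image (fun u => (closedNbhd G W u).card) hW
  set N := closedNbhd G W v with hN
  have hsub : ∀ u, closedNbhd G W u ⊆ W := fun u w hw => (mem_closedNbhd.1 hw).1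
  have hcover : maxIndepSets G W ⊆
      N.biUnion fun u => {I ∈ maxIndepSets G W | u ∈ I} := by
    intro I hI
    obtain ⟨hIW, hind, hmax⟩ := mem_maxIndepSets.1 hI
    simp only [Finset.mem_biUnion, Finset.mem_filter]
    by_cases hvI : v ∈ I
    · exact ⟨v, mem_closedNbhd.2 ⟨hv, Or.inl rfl⟩, hI, hvI⟩
    · obtain ⟨u, hu, hvu⟩ := hmax v hv hvI
      exact ⟨u, mem_closedNbhd.2 ⟨hIW hu, Or.inr hvu⟩, hI, hu⟩
  have hbranch : ∀ u ∈ N, (({I ∈ maxIndepSets G W | u ∈ I} : Finset (Finset V)).card : ℝ) ≤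
      c ^ (W.card - N.card) := by
    intro u hu
    have huW : u ∈ W := hsub v hu
    have hle : ({I ∈ maxIndepSets G W | u ∈ I} : Finset (Finset V)).card ≤
        (maxIndepSets G (W \ closedNbhd G W u)).card := by
      refine Finset.card_le_card_of_injOn (fun I => I.erase u) ?_ ?_
      · intro I hI
        have hI := Finset.mem_filter.1 (Finset.mem_coe.1 hI)
        exact erase_mem_maxIndepSets hI.1 hI.2
      · intro I hI J hJ h
        have hI := (Finset.mem_filter.1 (Finset.mem_coe.1 hI)).2
        have hJ := (Finset.mem_filter.1 (Finset.mem_coe.1 hJ)).2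
        rw [← Finset.insert_erase hI, ← Finset.insert_erase hJ]
        exact congrArg (insert u) h
    have hss : W \ closedNbhd G W u ⊂ W :=
      Finset.sdiff_ssubset (hsub u) ⟨u, mem_closedNbhd.2 ⟨huW, Or.inl rfl⟩⟩
    calc (({I ∈ maxIndepSets G W | u ∈ I} : Finset (Finset V)).card : ℝ)
        ≤ ((maxIndepSets G (W \ closedNbhd G W u)).card : ℝ) := by exact_mod_cast hle
      _ ≤ c ^ (W \ closedNbhd G W u).card := ih _ hss
      _ ≤ c ^ (W.card - N.card) := by
        refine pow_le_pow_right₀ hc ?_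
        rw [Finset.card_sdiff_of_subset (hsub u)]
        exact Nat.sub_le_sub_left (hmin u huW) _
  calc ((maxIndepSets G W).card : ℝ)
      ≤ ∑ u ∈ N, (({I ∈ maxIndepSets G W | u ∈ I} : Finset (Finset V)).card : ℝ) := by
        exact_mod_cast (Finset.card_le_card hcover).trans Finset.card_biUnion_le
    _ ≤ N.card * c ^ (W.card - N.card) := by
        simpa using Finset.sum_le_sum hbranch
    _ ≤ c ^ N.card * c ^ (W.card - N.card) := by
        gcongr
        exact hck _
    _ = c ^ W.card := by
        rw [← pow_add, Nat.add_sub_cancel' (Finset.card_le_card (hsub v))]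

end MaximalIndependentSets

/-! ### Sinks and minimal deletion sets. -/

variable {V : Type*}

lemma eq_of_reflTransGen_of_sink {r : V → V → Prop} {z w : V} (hz : ∀ w, r z w → w = z)
    (h : ReflTransGen r z w) : w = z := by
  induction h with
  | refl => rfl
  | tail _ h ih => subst ih; exact hz _ h

/-- A finite digraph is knot-free iff each vertex reaches a vertex without out-neighbours other
than itself. -/
theorem isKnotFree_iff [Finite V] (D : Digraph V) :
    IsKnotFree D ↔ ∀ v, ∃ z, ReflTransGen D.Adj v z ∧ ∀ w, D.Adj z w → w = z := by
  constructor
  · intro h v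
    -- By minimality, whatever `z` reaches also reaches `z`; a second out-neighbour would make this
    -- reach set a knot.
    obtain ⟨z, hvz, hmin⟩ := Set.exists_min_image {z | ReflTransGen D.Adj v z}
      (fun z => {w | ReflTransGen D.Adj z w}.ncard) (Set.toFinite _) ⟨v, .refl⟩
    refine ⟨z, hvz, fun w hw => ?_⟩
    by_contra hne
    have hback : ∀ u, ReflTransGen D.Adj z u → ReflTransGen D.Adj u z := by
      intro u hu
      have heq : {w | ReflTransGen D.Adj u w} = {w | ReflTransGen D.Adj z w} :=
        Set.eq_of_subset_of_ncard_le (fun w hw => hu.trans hw) (hmin u (hvz.trans hu))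
          (Set.toFinite _)
      have : z ∈ {w | ReflTransGen D.Adj u w} := heq ▸ ReflTransGen.refl
      exact this
    refine h {w | ReflTransGen D.Adj z w} ⟨⟨⟨z, .refl⟩, fun u hu t => ⟨fun ht => ?_, fun ht => ?_⟩⟩,
      ⟨w, .single hw, z, .refl, hne⟩, fun u hu t ht hut => ht (ReflTransGen.tail hu hut)⟩
    · exact ⟨(hback u hu).trans ht, (hback t ht).trans hu⟩
    · exact ReflTransGen.trans hu ht.1
  · rintro h K ⟨⟨⟨u, hu⟩, hK⟩, hnt, hclosed⟩
    obtain ⟨z, huz, hz⟩ := h u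
    have hzK : z ∈ K := by
      clear hz
      induction huz with
      | refl => exact hu
      | tail _ hbc ih => exact by_contra fun hc => hclosed _ ih _ hc hbc
    obtain ⟨w, hw, hne⟩ := hnt.exists_ne z
    exact hne (eq_of_reflTransGen_of_sink hz ((hK z hzK w).1 hw).1)

/-- The arcs of `D` whose head avoids `S`. -/
def AdjOff (D : Digraph V) (S : Set V) (a b : V) : Prop :=
  D.Adj a b ∧ b ∉ S

/-- The sinks of `D - S`, loops being ignored. -/
def sinks (D : Digraph V) (S : Set V) : Set V :=
  {z | z ∉ S ∧ ∀ w, AdjOff D S z w → w = z}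

/-- The out-neighbours of `z` other than `z`. -/
def outNbhd (D : Digraph V) (z : V) : Set V :=
  {w | D.Adj z w ∧ w ≠ z}

/-- The vertices that reach `z` in `D - N⁺(z)`. -/
def basin (D : Digraph V) (z : V) : Set V :=
  {v | v ∉ outNbhd D z ∧ ReflTransGen (AdjOff D (outNbhd D z)) v z}

lemma reflTransGen_deleteVerts_iff (D : Digraph V) (S : Set V) (u v : {v : V // v ∉ S}) :
    ReflTransGen (deleteVerts D S).Adj u v ↔ ReflTransGen (AdjOff D S) u v := by
  constructor
  · intro h
    induction h with
    | refl => exact .refl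
    | @tail b c _ hbc ih => exact ih.tail ⟨hbc, c.2⟩
  · obtain ⟨v, hv⟩ := v
    intro h
    change ReflTransGen (AdjOff D S) u v at h
    induction h with
    | refl => exact .refl
    | @tail b c hab hbc ih =>
      have hb : b ∉ S := by
        rcases hab.cases_tail with h | ⟨_, -, h⟩
        · exact h ▸ u.2
        · exact h.2
      exact (ih hb).tail hbc.1

lemma isDeletionSet_iff [Finite V] (D : Digraph V) (S : Set V) :
    IsDeletionSet D S ↔ ∀ v ∉ S, ∃ z ∈ sinks D S, ReflTransGen (AdjOff D S) v z := by
  rw [IsDeletionSet, isKnotFree_iff]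
  constructor
  · intro h v hv
    obtain ⟨z, hvz, hz⟩ := h ⟨v, hv⟩
    exact ⟨z, ⟨z.2, fun w hw => congrArg Subtype.val (hz ⟨w, hw.2⟩ hw.1)⟩,
      (reflTransGen_deleteVerts_iff D S _ _).1 hvz⟩
  · rintro h ⟨v, hv⟩
    obtain ⟨z, hz, hvz⟩ := h v hv
    exact ⟨⟨z, hz.1⟩, (reflTransGen_deleteVerts_iff D S ⟨v, hv⟩ ⟨z, hz.1⟩).2 hvz,
      fun w hw => Subtype.ext (hz.2 w ⟨hw, w.2⟩)⟩

lemma outNbhd_subset_of_mem_sinks {D : Digraph V} {S : Set V} {z : V} (hz : z ∈ sinks D S) :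
    outNbhd D z ⊆ S := fun w hw => by_contra fun hwS => hw.2 (hz.2 w ⟨hw.1, hwS⟩)

lemma AdjOff.mono {D : Digraph V} {S T : Set V} (h : T ⊆ S) {a b : V} (hab : AdjOff D S a b) :
    AdjOff D T a b := ⟨hab.1, fun hb => hab.2 (h hb)⟩

/-- A minimal deletion set consists of the out-neighbours of the sinks it leaves behind. -/
theorem exists_sink_of_mem [Finite V] {D : Digraph V} {S : Set V}
    (hS : Minimal (IsDeletionSet D) S) {v : V} (hv : v ∈ S) :
    ∃ z ∈ sinks D S, v ∈ outNbhd D z := by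
  -- Otherwise `v` can be restored: old sinks survive, and `v` is itself a sink or has an arc to a
  -- vertex outside `S`.
  by_contra! hno
  have hsub : S \ {v} ⊆ S := Set.sdiff_subset
  have hreach := (isDeletionSet_iff D S).1 hS.prop
  have hmem : ∀ w, w ∉ S \ {v} → w ∉ S ∨ w = v := fun w hw => by
    by_contra! h
    exact hw h
  have hsink : ∀ z ∈ sinks D S, z ∈ sinks D (S \ {v}) := by
    refine fun z hz => ⟨fun h => hz.1 (hsub h), fun w hw => ?_⟩
    rcases hmem w hw.2 with h | rfl
    · exact hz.2 w ⟨hw.1, h⟩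
    · by_contra hne
      exact hno z hz ⟨hw.1, hne⟩
  have hout : ∀ w ∉ S, ∃ z ∈ sinks D (S \ {v}), ReflTransGen (AdjOff D (S \ {v})) w z := by
    intro w hw
    obtain ⟨z, hz, hwz⟩ := hreach w hw
    exact ⟨z, hsink z hz, ReflTransGen.mono (fun _ _ => AdjOff.mono hsub) _ _ hwz⟩
  have hdel : IsDeletionSet D (S \ {v}) := by
    rw [isDeletionSet_iff]
    intro w hw
    rcases hmem w hw with h | rfl
    · exact hout w h
    · by_cases hs : w ∈ sinks D (S \ {w})
      · exact ⟨w, hs, .refl⟩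
      · have : ∃ t, AdjOff D (S \ {w}) w t ∧ t ≠ w := by
          by_contra! h
          exact hs ⟨hw, h⟩
        obtain ⟨t, ht, htw⟩ := this
        obtain ⟨z, hz, htz⟩ := hout t ((hmem t ht.2).resolve_right htw)
        exact ⟨z, hz, htz.head ht⟩
  exact (hS.le_of_le hdel hsub hv).2 rfl

/-- A minimal deletion set spares every vertex that reaches one of its sinks `z` in
`D - N⁺(z)`. -/
theorem disjoint_basin [Finite V] {D : Digraph V} {S : Set V}
    (hS : Minimal (IsDeletionSet D) S) {z : V} (hz : z ∈ sinks D S) :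
    Disjoint S (basin D z) := by
  have hNS := outNbhd_subset_of_mem_sinks hz
  have hsub : S \ basin D z ⊆ S := Set.sdiff_subset
  have hNT : outNbhd D z ⊆ S \ basin D z := fun w hw => ⟨hNS hw, fun h => h.1 hw⟩
  -- Outside `N⁺(z)` the basin is closed under predecessors, so walks of `D - S` that start outside
  -- it never enter it, and restoring it spoils no sink there.
  have hback : ∀ {a b}, a ∉ outNbhd D z → D.Adj a b → b ∈ basin D z → a ∈ basin D z :=
    fun ha hab hb => ⟨ha, hb.2.head ⟨hab, hb.1⟩⟩
  have hdel : IsDeletionSet D (S \ basin D z) := by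
    rw [isDeletionSet_iff]
    intro v hv
    by_cases hvB : v ∈ basin D z
    · refine ⟨z, ⟨fun h => hz.1 h.1, fun w hw => by_contra fun hne => hw.2 (hNT ⟨hw.1, hne⟩)⟩, ?_⟩
      obtain ⟨-, hvz⟩ := hvB
      clear hv
      induction hvz using ReflTransGen.head_induction_on with
      | refl => exact .refl
      | head hab hbz ih => exact ih.head ⟨hab.1, fun h => h.2 ⟨hab.2, hbz⟩⟩
    · have hvS : v ∉ S := fun h => hv ⟨h, hvB⟩
      obtain ⟨y, hy, hvy⟩ := (isDeletionSet_iff D S).1 hS.prop v hvS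
      have hyB : y ∉ basin D z := by
        have : y ∉ S ∧ y ∉ basin D z := by
          clear hy
          induction hvy with
          | refl => exact ⟨hvS, hvB⟩
          | tail _ hbc ih =>
            exact ⟨hbc.2, fun h => ih.2 (hback (fun h' => ih.1 (hNS h')) hbc.1 h)⟩
        exact this.2
      refine ⟨y, ⟨fun h => hy.1 h.1, fun w hw => ?_⟩, ReflTransGen.mono (fun _ _ => AdjOff.mono hsub) _ _ hvy⟩
      refine hy.2 w ⟨hw.1, fun hwS => hw.2 ⟨hwS, fun h => ?_⟩⟩
      exact hyB (hback (fun h' => hy.1 (hNS h')) hw.1 h)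
  exact Set.disjoint_left.2 fun w hw hwB => (hS.le_of_le hdel hsub hw).2 hwB

/-! ### The conflict graph and the injection. -/

/-- Two vertices conflict if making one of them a sink decides the fate of the other. -/
def conflictGraph (D : Digraph V) : SimpleGraph V :=
  SimpleGraph.fromRel fun u z => u ∈ outNbhd D z ∨ u ∈ basin D z

lemma not_mem_outNbhd_or_basin [Finite V] {D : Digraph V} {S : Set V}
    (hS : Minimal (IsDeletionSet D) S) {y z : V} (hy : y ∈ sinks D S) (hz : z ∈ sinks D S)
    (hne : y ≠ z) : ¬ (y ∈ outNbhd D z ∨ y ∈ basin D z) := by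
  rintro (h | ⟨-, h⟩)
  · exact hy.1 (outNbhd_subset_of_mem_sinks hz h)
  -- The walk from `y` to `z` stays in the basin, which `S` avoids, so it survives in `D - S`; but
  -- the sink `y` cannot be left.
  · refine hne (eq_of_reflTransGen_of_sink (r := AdjOff D S) hy.2 ?_).symm
    clear hy hne
    induction h using ReflTransGen.head_induction_on with
    | refl => exact .refl
    | head hab hbz ih =>
      exact ih.head ⟨hab.1, fun hS' => Set.disjoint_left.1 (disjoint_basin hS hz) hS' ⟨hab.2, hbz⟩⟩

lemma sinks_independent [Finite V] {D : Digraph V} {S : Set V}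
    (hS : Minimal (IsDeletionSet D) S) {y z : V} (hy : y ∈ sinks D S) (hz : z ∈ sinks D S) :
    ¬ (conflictGraph D).Adj y z := by
  rintro ⟨hne, h | h⟩
  · exact not_mem_outNbhd_or_basin hS hy hz hne h
  · exact not_mem_outNbhd_or_basin hS hz hy hne.symm h

lemma exists_sink_conflict [Finite V] {D : Digraph V} {S : Set V}
    (hS : Minimal (IsDeletionSet D) S) {v : V} (hv : v ∉ sinks D S) :
    ∃ z ∈ sinks D S, (conflictGraph D).Adj v z := by
  suffices ∃ z ∈ sinks D S, v ∈ outNbhd D z ∨ v ∈ basin D z by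
    obtain ⟨z, hz, h⟩ := this
    exact ⟨z, hz, fun h' => hv (h' ▸ hz), Or.inl h⟩
  by_cases hvS : v ∈ S
  · obtain ⟨z, hz, h⟩ := exists_sink_of_mem hS hvS
    exact ⟨z, hz, Or.inl h⟩
  · obtain ⟨z, hz, h⟩ := (isDeletionSet_iff D S).1 hS.prop v hvS
    have hN := outNbhd_subset_of_mem_sinks hz
    exact ⟨z, hz, Or.inr ⟨fun h' => hvS (hN h'), ReflTransGen.mono (fun _ _ => AdjOff.mono hN) _ _ h⟩⟩

lemma sinks_injOn [Finite V] (D : Digraph V) :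
    Set.InjOn (sinks D) (minimalDeletionSets D) := by
  have key : ∀ {S T : Set V}, Minimal (IsDeletionSet D) S → sinks D S = sinks D T → S ⊆ T := by
    intro S T hS h v hv
    obtain ⟨z, hz, hvz⟩ := exists_sink_of_mem hS hv
    exact outNbhd_subset_of_mem_sinks (h ▸ hz) hvz
  exact fun S hS T hT h => (key hS h).antisymm (key hT h.symm)

/-- There are at most as many minimal deletion sets as maximal independent sets of the conflict
graph. -/
theorem ncard_minimalDeletionSets_le [Fintype V] [DecidableEq V] (D : Digraph V) :
    (minimalDeletionSets D).ncard ≤ (maxIndepSets (conflictGraph D) Finset.univ).card := by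
  classical
  rw [← Set.ncard_coe_finset]
  refine Set.ncard_le_ncard_of_injOn (fun S => (sinks D S).toFinset) (fun S hS => ?_)
    (fun S hS T hT h => sinks_injOn D hS hT (Set.toFinset_inj.1 h)) (Set.toFinite _)
  rw [Finset.mem_coe, mem_maxIndepSets]
  simp only [Set.mem_toFinset]
  exact ⟨Finset.subset_univ _, fun y hy z hz => sinks_independent hS hy hz,
    fun v _ hv => exists_sink_conflict hS hv⟩

/-- The critical case is `k = 3`, where `1.4549 ^ 3 > 3`; from there each step adds at least `0.4549
* 3 > 1`. -/
lemma natCast_le_pow (k : ℕ) : (k : ℝ) ≤ (1.4549 : ℝ) ^ k := by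
  rcases lt_or_ge k 3 with h | h
  · interval_cases k <;> norm_num
  · induction k, h using Nat.le_induction with
    | base => norm_num
    | succ n hn ih =>
      have : (3 : ℝ) ≤ n := by exact_mod_cast hn
      rw [pow_succ]
      push_cast
      linarith

end KnotFree

theorem mainTheorem2 :
    ∃ p : Polynomial ℝ, ∀ (V : Type*) [Fintype V] (D : Digraph V),
      ((KnotFree.minimalDeletionSets D).ncard : ℝ) ≤
        p.eval (Fintype.card V : ℝ) * (1.4549 : ℝ) ^ Fintype.card V := by
  classical
  refine ⟨1, fun V _ D => ?_⟩
  rw [Polynomial.eval_one, one_mul]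
  calc ((KnotFree.minimalDeletionSets D).ncard : ℝ)
      ≤ ((KnotFree.maxIndepSets (KnotFree.conflictGraph D) Finset.univ).card : ℝ) := by
        exact_mod_cast KnotFree.ncard_minimalDeletionSets_le D
    _ ≤ (1.4549 : ℝ) ^ Fintype.card V :=
        KnotFree.card_maxIndepSets_le _ (by norm_num) KnotFree.natCast_le_pow _
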